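/- Let $\kappa$ be a field, $G$ an infinite group, and $\sigma\colon G\times G\to\kappa$ a factor set, i.e. there are a nonzero unital associative $\kappa$-algebra $R$ and a map $\Gamma\colon G\to R$ with $\Gamma(1)=1$ such that for all $g,h\in G$: $\Gamma(g^{-1})\Gamma(g)\Gamma(h)=\sigma(g,h)\Gamma(g^{-1})\Gamma(gh)$; $\Gamma(g)\Gamma(h)\Gamma(h^{-1})=\sigma(g,h)\Gamma(gh)\Gamma(h^{-1})$; if $\sigma(g,h)=0$ then $\Gamma(g^{-1})\Gamma(gh)=0=\Gamma(gh)\Gamma(h^{-1})$; and if $\Gamma(g)\Gamma(h)=0$ then $\sigma(g,h)=0$. The set of factor sets is denoted $pm(G)$. Let $\kappa_{par}^\sigma G$ be the universal unital $\kappa$-algebra generated by symbols $[g]$ ($g\in G$) with $[1]=1$ subject to $[g^{-1}][g][h]=\sigma(g,h)[g^{-1}][gh]$, $[g][h][h^{-1}]=\sigma(g,h)[gh][h^{-1}]$, and $[g^{-1}][gh]=0=[gh][h^{-1}]$ whenever $\sigma(g,h)=0$. Put $e_g=\sigma(g,g^{-1})^{-1}[g][g^{-1}]$ if $\sigma(g,g^{-1})\ne0$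 and $e_g=0$ otherwise, and let $B^\sigma$ be the subalgebra generated by all $e_g$. Let $\hat B^\sigma$ be the set of unital $\kappa$-algebra homomorphisms $B^\sigma\to\kappa$ with the topology of pointwise convergence ($\kappa$ discrete); it is the spectrum of $B^\sigma$. The spectral partial action $\hat\theta$ of $G$ on $\hat B^\sigma$ has domains $\hat D_g=\{f: f(e_g)=1\}$ and maps $\hat\theta_g\colon\hat D_{g^{-1}}\to\hat D_g$, $\hat\theta_g(f)(w)=f(\Theta_{g^{-1}}(w))$, where $\Theta_g(w)=\sigma(g^{-1},g)^{-1}[g]\,e_{g^{-1}}w\,[g^{-1}]$ (and $\Theta_g=0$ if $\sigma(g,g^{-1})=0$). Let $\Omega_\sigma$ be the set of all subsets $\xi\subseteq G$ with $1\in\xi$ that contain no set of the form $\{h,hg,hgs\}$ with $\sigma(g,s)=0$ and no set of the form $\{h,hg,hgs,hgst\}$ with $\sigma(g,st)\sigma(s,t)\neq\sigma(g,s)\sigma(gs,t)$, with the topology induced from $\{0,1\}^G$. Under the identification of $\hat B^\sigma$ with $\Omega_\sigma$ via $f\mapsto\{g: f(e_g)=1\}$, the spectral partial action becomes the partial action on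 $\Omega_\sigma$ with domains $\mathcal D_g=\{\xi\in\Omega_\sigma: g\in\xi\}$ and maps $\mathcal D_{g^{-1}}\to\mathcal D_g$, $\xi\mapsto g\xi$. Put $\mathrm{Fix}_g^\sigma=\{\xi\in\Omega_\sigma: g^{-1}\in\xi,\ g\xi=\xi\}$ and $A_\sigma(\xi)=\{g\in G\setminus\xi:\xi\cup\{g\}\in\Omega_\sigma\}$. A partial action $(\{X_g\},\{\theta_g\})$ on a topological space $X$ is topologically free if for every $g\ne1$ the set $\{x\in X_{g^{-1}}:\theta_g(x)=x\}$ has empty interior in $X$. **Theorem.** The following are equivalent: (i) the spectral partial action is not topologically free, (a) as a partial action on $\hat B^\sigma$, or, equivalently, (b) as a partial action on $\Omega_\sigma$; (ii) there is $g\in G$, $g\neq1$, such that $\mathrm{Fix}_g^\sigma$ contains an isolated point of $\Omega_\sigma$; (iii) there are $g\in G$, $g\neq 1$, and $\xi\in\mathrm{Fix}_g^\sigma$ such that both $\xi$ and $A_\sigma(\xi)$ are finite. -/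

import Mathlib

/-! ## Topological partial actions -/

/-- A topological partial action of a group `G` on a topological space `X`: open sets `X_g = dom g`
and homeomorphisms `θ_g = act g : X_{g⁻¹} ≃ₜ X_g`. -/
structure TopPartialAction (G : Type*) (X : Type*) [Group G] [TopologicalSpace X] where
  dom : G → Set X
  isOpen_dom : ∀ g, IsOpen (dom g)
  act : ∀ g, dom g⁻¹ ≃ₜ dom g
  dom_one : dom 1 = Set.univ
  act_one : ∀ x : dom (1 : G)⁻¹, (act 1 x : X) = x
  image_act : ∀ g h : G,
    (fun x : dom g⁻¹ => (act g x : X)) '' {x | (x : X) ∈ dom h} = dom g ∩ dom (g * h)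
  act_act : ∀ (g h : G) (x : X) (hx : x ∈ dom h⁻¹) (hgh : x ∈ dom (g * h)⁻¹),
    ∃ hy : (act h ⟨x, hx⟩ : X) ∈ dom g⁻¹,
      (act g ⟨(act h ⟨x, hx⟩ : X), hy⟩ : X) = (act (g * h) ⟨x, hgh⟩ : X)

namespace TopPartialAction

variable {G : Type*} {X : Type*} [Group G] [TopologicalSpace X]

/-- The set `{x ∈ X_{g⁻¹} : θ_g(x) = x}`. -/
def fixedSet (θ : TopPartialAction G X) (g : G) : Set X :=
  {x | ∃ hx : x ∈ θ.dom g⁻¹, (θ.act g ⟨x, hx⟩ : X) = x}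

/-- Topological freeness: the fixed set of each `g ≠ 1` has empty interior. -/
def TopologicallyFree (θ : TopPartialAction G X) : Prop :=
  ∀ g : G, g ≠ 1 → interior (θ.fixedSet g) = ∅

end TopPartialAction

/-! ## Partial projective representations, factor sets, the twisted partial group algebra -/

/-- `Γ` is a partial projective `σ`-representation of `G` in the unital `κ`-algebra `R`. -/
structure IsPartialProjRep {κ G R : Type*} [Field κ] [Group G] [Ring R] [Algebra κ R]
    (σ : G → G → κ) (Γ : G → R) : Prop where
  zero_left : ∀ g h, σ g h = 0 → Γ g⁻¹ * Γ (g * h) = 0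
  zero_right : ∀ g h, σ g h = 0 → Γ (g * h) * Γ h⁻¹ = 0
  eq_zero : ∀ g h, Γ g * Γ h = 0 → σ g h = 0
  map_one : Γ 1 = 1
  mul_left : ∀ g h, Γ g⁻¹ * Γ g * Γ h = σ g h • (Γ g⁻¹ * Γ (g * h))
  mul_right : ∀ g h, Γ g * Γ h * Γ h⁻¹ = σ g h • (Γ (g * h) * Γ h⁻¹)

universe u v

/-- `pm(G)`: the set of factor sets of partial projective representations of `G` over `κ`. The
universe of `R` is no restriction: if `σ` is a factor set of some representation, it is one of
the universal one, in the twisted partial group algebra below. -/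
def pm (κ : Type u) (G : Type v) [Field κ] [Group G] : Set (G → G → κ) :=
  {σ | ∃ (R : Type (max u v)) (_ : Ring R) (_ : Algebra κ R) (_ : Nontrivial R) (Γ : G → R),
    IsPartialProjRep σ Γ}

section Algebra

variable {κ : Type u} {G : Type v} [Field κ] [Group G]

/-- The defining relations of the twisted partial group algebra (as a unital algebra with unit
`[1_G]`). -/
inductive ParRel (σ : G → G → κ) : FreeAlgebra κ G → FreeAlgebra κ G → Prop
  | one : ParRel σ (FreeAlgebra.ι κ 1) 1
  | zero_left (g h : G) : σ g h = 0 →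
      ParRel σ (FreeAlgebra.ι κ g⁻¹ * FreeAlgebra.ι κ (g * h)) 0
  | zero_right (g h : G) : σ g h = 0 →
      ParRel σ (FreeAlgebra.ι κ (g * h) * FreeAlgebra.ι κ h⁻¹) 0
  | mul_left (g h : G) :
      ParRel σ (FreeAlgebra.ι κ g⁻¹ * FreeAlgebra.ι κ g * FreeAlgebra.ι κ h)
        (σ g h • (FreeAlgebra.ι κ g⁻¹ * FreeAlgebra.ι κ (g * h)))
  | mul_right (g h : G) :
      ParRel σ (FreeAlgebra.ι κ g * FreeAlgebra.ι κ h * FreeAlgebra.ι κ h⁻¹)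
        (σ g h • (FreeAlgebra.ι κ (g * h) * FreeAlgebra.ι κ h⁻¹))

/-- The twisted partial group algebra `κ_par^σ G`. -/
def ParAlg (σ : G → G → κ) : Type (max u v) := RingQuot (ParRel σ)

noncomputable instance (σ : G → G → κ) : Ring (ParAlg σ) :=
  inferInstanceAs (Ring (RingQuot (ParRel σ)))

noncomputable instance (σ : G → G → κ) : Algebra κ (ParAlg σ) :=
  inferInstanceAs (Algebra κ (RingQuot (ParRel σ)))

namespace ParAlg

variable (σ : G → G → κ)

/-- The quotient map from the free algebra. -/
noncomputable def mk : FreeAlgebra κ G →ₐ[κ] ParAlg σ := RingQuot.mkAlgHom κ (ParRel σ)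

theorem mk_rel {x y : FreeAlgebra κ G} (h : ParRel σ x y) : mk σ x = mk σ y :=
  RingQuot.mkAlgHom_rel κ h

/-- The generator `[g]^σ`. -/
noncomputable def gen (g : G) : ParAlg σ := mk σ (FreeAlgebra.ι κ g)

open Classical in
/-- `e_g^σ = σ(g,g⁻¹)⁻¹ [g]^σ [g⁻¹]^σ` if `σ(g,g⁻¹) ≠ 0`, and `0` otherwise. -/
noncomputable def idem (g : G) : ParAlg σ :=
  if σ g g⁻¹ ≠ 0 then (σ g g⁻¹)⁻¹ • (gen σ g * gen σ g⁻¹) else 0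

/-- The subalgebra `B^σ` generated by the `e_g^σ`. -/
noncomputable def B : Subalgebra κ (ParAlg σ) := Algebra.adjoin κ (Set.range (idem σ))

theorem gen_one : gen σ 1 = 1 := by
  simpa [gen] using mk_rel σ (ParRel.one (σ := σ))

theorem gen_zero_left (g h : G) (hz : σ g h = 0) : gen σ g⁻¹ * gen σ (g * h) = 0 := by
  simpa [gen] using mk_rel σ (ParRel.zero_left (σ := σ) g h hz)

theorem gen_zero_right (g h : G) (hz : σ g h = 0) : gen σ (g * h) * gen σ h⁻¹ = 0 := by
  simpa [gen] using mk_rel σ (ParRel.zero_right (σ := σ) g h hz)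

theorem gen_mul_left (g h : G) :
    gen σ g⁻¹ * gen σ g * gen σ h = σ g h • (gen σ g⁻¹ * gen σ (g * h)) := by
  simpa [gen] using mk_rel σ (ParRel.mul_left (σ := σ) g h)

theorem gen_mul_right (g h : G) :
    gen σ g * gen σ h * gen σ h⁻¹ = σ g h • (gen σ (g * h) * gen σ h⁻¹) := by
  simpa [gen] using mk_rel σ (ParRel.mul_right (σ := σ) g h)

theorem gen_eq_zero {g : G} (h : σ g g⁻¹ = 0) : gen σ g = 0 := by
  have := gen_zero_right σ g g⁻¹ h
  simpa [gen_one] using this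

theorem gen_eq_zero' {g : G} (h : σ g⁻¹ g = 0) : gen σ g = 0 := by
  have := gen_zero_left σ g⁻¹ g h
  simpa [gen_one] using this

theorem gen_mul_gen_inv (g : G) : gen σ g * gen σ g⁻¹ = σ g g⁻¹ • idem σ g := by
  unfold idem
  split_ifs with h
  · rw [smul_smul, mul_inv_cancel₀ h, one_smul]
  · rw [gen_eq_zero σ (not_not.1 h)]; simp

theorem idem_mul_gen (g : G) : idem σ g * gen σ g = gen σ g := by
  by_cases h : σ g g⁻¹ = 0
  · simp [gen_eq_zero σ h]
  · have := gen_mul_right σ g g⁻¹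
    rw [gen_mul_gen_inv, inv_inv, mul_inv_cancel, gen_one, one_mul, smul_mul_assoc] at this
    exact smul_right_injective _ h this

theorem gen_mul_idem (g : G) : gen σ g * idem σ g⁻¹ = gen σ g := by
  by_cases h : σ g⁻¹ g = 0
  · simp [gen_eq_zero' σ h]
  · have h1 := gen_mul_left σ g⁻¹ g
    have h2 := gen_mul_gen_inv σ g⁻¹
    rw [inv_inv] at h1 h2
    rw [mul_assoc, h2, inv_mul_cancel, gen_one, mul_one, mul_smul_comm] at h1
    exact smul_right_injective _ h h1

theorem gen_inv_mul_idem (g : G) : gen σ g⁻¹ * idem σ g = gen σ g⁻¹ := by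
  simpa using gen_mul_idem σ g⁻¹

theorem idem_eq_zero {g : G} (h : σ g g⁻¹ = 0) : idem σ g = 0 := by simp [idem, h]

/-- `e_g` is a multiple of `[g][g⁻¹]`. -/
theorem idem_eq (g : G) : idem σ g = (σ g g⁻¹)⁻¹ • (gen σ g * gen σ g⁻¹) := by
  unfold idem
  split_ifs with h
  · rfl
  · simp [not_not.1 h]

theorem gen_mul_idem_comm (g h : G) : gen σ g * idem σ h = idem σ (g * h) * gen σ g := by
  have h1 : gen σ g * idem σ h = ((σ h h⁻¹)⁻¹ * σ g h) • (gen σ (g * h) * gen σ h⁻¹) := by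
    rw [idem_eq, mul_smul_comm, ← mul_assoc, gen_mul_right, smul_smul]
  have h2 : idem σ (g * h) * gen σ g =
      ((σ (g * h) (g * h)⁻¹)⁻¹ * σ (g * h)⁻¹ g) • (gen σ (g * h) * gen σ h⁻¹) := by
    have := gen_mul_left σ (g * h)⁻¹ g
    rw [inv_inv, show (g * h)⁻¹ * g = h⁻¹ by group] at this
    rw [idem_eq, smul_mul_assoc, this, smul_smul]
  have h3 : idem σ (g * h) * (gen σ g * idem σ h) = gen σ g * idem σ h := by
    rw [h1, mul_smul_comm, ← mul_assoc, idem_mul_gen]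
  have h4 : idem σ (g * h) * gen σ g * idem σ h = idem σ (g * h) * gen σ g := by
    rw [h2, smul_mul_assoc, mul_assoc, gen_inv_mul_idem]
  rw [← h3, ← mul_assoc, h4]

theorem idem_mul_self (g : G) : idem σ g * idem σ g = idem σ g := by
  nth_rewrite 1 [idem_eq σ g]
  rw [smul_mul_assoc, mul_assoc, gen_inv_mul_idem, ← idem_eq]

theorem idem_comm (g h : G) : idem σ g * idem σ h = idem σ h * idem σ g := by
  rw [idem_eq σ g, smul_mul_assoc, mul_smul_comm, mul_assoc, gen_mul_idem_comm, ← mul_assoc,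
    gen_mul_idem_comm, mul_assoc, mul_inv_cancel_left]

theorem idem_one : idem σ (1 : G) = 1 := by
  have := idem_mul_gen σ (1 : G)
  rwa [gen_one, mul_one] at this

theorem idem_mem (g : G) : idem σ g ∈ B σ := Algebra.subset_adjoin ⟨g, rfl⟩

theorem B_comm {x y : ParAlg σ} (hx : x ∈ B σ) (hy : y ∈ B σ) : x * y = y * x := by
  have key := Algebra.adjoin_le_centralizer_centralizer κ (Set.range (idem σ))
  have hy' := key hy
  rw [Subalgebra.mem_centralizer_iff] at hy'
  refine hy' x ?_
  have hx' : x ∈ Subalgebra.centralizer κ (Set.range (idem σ)) := by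
    have : B σ ≤ Subalgebra.centralizer κ (Set.range (idem σ)) := by
      refine Algebra.adjoin_le ?_
      rintro _ ⟨g, rfl⟩
      rw [SetLike.mem_coe, Subalgebra.mem_centralizer_iff]
      rintro _ ⟨h, rfl⟩
      exact idem_comm σ h g
    exact this hx
  exact hx'

theorem gen_mul_mul_gen (g : G) {x : ParAlg σ} (y : ParAlg σ) (hx : x ∈ B σ) :
    gen σ g * x * gen σ g⁻¹ * (gen σ g * y * gen σ g⁻¹) =
      σ g⁻¹ g • (gen σ g * (x * y) * gen σ g⁻¹) := by
  have h := gen_mul_gen_inv σ g⁻¹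
  rw [inv_inv] at h
  calc gen σ g * x * gen σ g⁻¹ * (gen σ g * y * gen σ g⁻¹)
      = gen σ g * (x * (gen σ g⁻¹ * gen σ g)) * y * gen σ g⁻¹ := by simp only [mul_assoc]
    _ = σ g⁻¹ g • (gen σ g * (x * y) * gen σ g⁻¹) := by
      rw [h, mul_smul_comm, B_comm σ hx (idem_mem σ g⁻¹), mul_smul_comm, ← mul_assoc (gen σ g),
        gen_mul_idem, smul_mul_assoc, smul_mul_assoc, mul_assoc (gen σ g)]

theorem gen_mul_mem (g : G) {x : ParAlg σ} (hx : x ∈ B σ) : gen σ g * x * gen σ g⁻¹ ∈ B σ := by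
  induction hx using Algebra.adjoin_induction with
  | mem x hx =>
    obtain ⟨h, rfl⟩ := hx
    rw [gen_mul_idem_comm, mul_assoc, gen_mul_gen_inv]
    exact mul_mem (idem_mem σ _) ((B σ).smul_mem (idem_mem σ _) _)
  | algebraMap r =>
    rw [← Algebra.commutes, mul_assoc, gen_mul_gen_inv, ← Algebra.smul_def]
    exact (B σ).smul_mem ((B σ).smul_mem (idem_mem σ _) _) _
  | add x y _ _ hx hy =>
    rw [mul_add, add_mul]
    exact add_mem hx hy
  | mul x y hxB _ hx hy =>
    by_cases h : σ g⁻¹ g = 0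
    · rw [gen_eq_zero' σ h]; simp
    · have := gen_mul_mul_gen σ g y hxB
      rw [← inv_smul_eq_iff₀ h] at this
      rw [← this]
      exact (B σ).smul_mem (mul_mem hx hy) _

/-- The generating idempotent `e_g^σ` as an element of `B^σ`. -/
noncomputable def e (g : G) : B σ := ⟨idem σ g, idem_mem σ g⟩

/-- `Θ_g(w) = θ_g(e_{g⁻¹} w)` for `w ∈ B^σ`, where `θ_g(w) = σ(g⁻¹,g)⁻¹ [g] w [g⁻¹]` if
`σ(g,g⁻¹) ≠ 0`, and `θ_g = 0` otherwise (if `σ(g,g⁻¹) = 0` then `[g] = 0`). -/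
noncomputable def Theta (g : G) (w : B σ) : B σ :=
  ⟨(σ g⁻¹ g)⁻¹ • (gen σ g * ((e σ g⁻¹ : B σ) * w : B σ) * gen σ g⁻¹),
    (B σ).smul_mem (gen_mul_mem σ g ((e σ g⁻¹ : B σ) * w : B σ).2) _⟩

theorem coe_Theta (g : G) (w : B σ) :
    (Theta σ g w : ParAlg σ) = (σ g⁻¹ g)⁻¹ • (gen σ g * w * gen σ g⁻¹) := by
  simp only [Theta, e, Subalgebra.coe_mul]
  rw [← mul_assoc (gen σ g), gen_mul_idem]

theorem gen_smul_comm (g : G) : σ g g⁻¹ • gen σ g = σ g⁻¹ g • gen σ g := by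
  have h1 := gen_mul_right σ g g⁻¹
  have h2 := gen_mul_left σ g⁻¹ g
  rw [inv_inv, mul_inv_cancel, gen_one, one_mul] at h1
  rw [inv_inv, inv_mul_cancel, gen_one, mul_one] at h2
  rw [← h1, h2]

theorem smul_gen_mul_gen_inv (g : G) : (σ g⁻¹ g)⁻¹ • (gen σ g * gen σ g⁻¹) = idem σ g := by
  by_cases hz : gen σ g = 0
  · rw [idem_eq, hz]; simp
  · have h1 : σ g g⁻¹ = σ g⁻¹ g := by
      have := gen_smul_comm σ g
      rw [← sub_eq_zero, ← sub_smul, smul_eq_zero] at this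
      exact sub_eq_zero.1 (this.resolve_right hz)
    rw [idem_eq, h1]

theorem Theta_one (g : G) : Theta σ g 1 = e σ g := by
  apply Subtype.ext
  rw [coe_Theta]
  simpa [e] using smul_gen_mul_gen_inv σ g

theorem Theta_e (g h : G) : Theta σ g (e σ h) = e σ (g * h) * e σ g := by
  apply Subtype.ext
  rw [coe_Theta]
  simp only [e, Subalgebra.coe_mul]
  rw [gen_mul_idem_comm, mul_assoc, ← mul_smul_comm, smul_gen_mul_gen_inv]

theorem Theta_mul (g : G) (w z : B σ) : Theta σ g (w * z) = Theta σ g w * Theta σ g z := by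
  apply Subtype.ext
  rw [Subalgebra.coe_mul, coe_Theta, coe_Theta, coe_Theta, smul_mul_smul_comm,
    gen_mul_mul_gen σ g _ w.2, smul_smul, Subalgebra.coe_mul]
  by_cases h : σ g⁻¹ g = 0
  · simp [h]
  · rw [mul_assoc (σ g⁻¹ g)⁻¹, inv_mul_cancel₀ h, mul_one]

theorem Theta_add (g : G) (w z : B σ) : Theta σ g (w + z) = Theta σ g w + Theta σ g z := by
  apply Subtype.ext
  simp [coe_Theta, mul_add, add_mul]

theorem Theta_smul (g : G) (r : κ) (w : B σ) : Theta σ g (r • w) = r • Theta σ g w := by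
  apply Subtype.ext
  simp [coe_Theta, smul_comm r]

end ParAlg

/-! ## The spectral partial action on the spectrum of `B^σ` -/

open ParAlg

/-- The spectrum of `B^σ`: the set of `κ`-algebra homomorphisms `B^σ → κ`. -/
def BHat (σ : G → G → κ) : Type (max u v) := B σ →ₐ[κ] κ

namespace BHat

variable {σ : G → G → κ}

/-- The value of the homomorphism `f` at `w`. -/
noncomputable def eval (f : BHat σ) (w : B σ) : κ := (show B σ →ₐ[κ] κ from f) w

/-- The topology of pointwise convergence, `κ` being discrete. -/
noncomputable instance : TopologicalSpace (BHat σ) :=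
  TopologicalSpace.induced (eval (σ := σ)) (@Pi.topologicalSpace (B σ) (fun _ => κ) (fun _ => ⊥))

theorem eval_one (f : BHat σ) : f.eval 1 = 1 := map_one (show B σ →ₐ[κ] κ from f)

theorem eval_mul (f : BHat σ) (w z : B σ) : f.eval (w * z) = f.eval w * f.eval z :=
  map_mul (show B σ →ₐ[κ] κ from f) w z

theorem eval_add (f : BHat σ) (w z : B σ) : f.eval (w + z) = f.eval w + f.eval z :=
  map_add (show B σ →ₐ[κ] κ from f) w z

theorem eval_smul (f : BHat σ) (r : κ) (w : B σ) : f.eval (r • w) = r * f.eval w :=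
  map_smul (show B σ →ₐ[κ] κ from f) r w

theorem ext_e {f f' : BHat σ} (h : ∀ g, f.eval (e σ g) = f'.eval (e σ g)) : f = f' := by
  refine AlgHom.ext (φ₁ := (show B σ →ₐ[κ] κ from f)) (φ₂ := (show B σ →ₐ[κ] κ from f')) ?_
  rintro ⟨x, hx⟩
  change f.eval _ = f'.eval _
  induction hx using Algebra.adjoin_induction with
  | mem x hx =>
    obtain ⟨g, rfl⟩ := hx
    exact h g
  | algebraMap r =>
    exact ((show B σ →ₐ[κ] κ from f).commutes r).trans
      ((show B σ →ₐ[κ] κ from f').commutes r).symm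
  | add x y hxB hyB hx hy =>
    have h1 := eval_add f ⟨x, hxB⟩ ⟨y, hyB⟩
    have h2 := eval_add f' ⟨x, hxB⟩ ⟨y, hyB⟩
    rw [hx, hy, ← h2] at h1
    exact h1
  | mul x y hxB hyB hx hy =>
    have h1 := eval_mul f ⟨x, hxB⟩ ⟨y, hyB⟩
    have h2 := eval_mul f' ⟨x, hxB⟩ ⟨y, hyB⟩
    rw [hx, hy, ← h2] at h1
    exact h1

theorem isOpen_eval_eq (w : B σ) (a : κ) : IsOpen {f : BHat σ | f.eval w = a} := by
  let _ : TopologicalSpace κ := ⊥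
  have _ : DiscreteTopology κ := ⟨rfl⟩
  have hc : Continuous (eval (σ := σ)) := continuous_induced_dom
  exact ((isOpen_discrete ({a} : Set κ)).preimage ((continuous_apply w).comp hc))

variable (σ) in
/-- `D̂_g = D(e_g^σ) = {f : f(e_g^σ) = 1}`. -/
def dom (g : G) : Set (BHat σ) := {f | f.eval (e σ g) = 1}

/-- `θ̂_g(f) = f ∘ Θ_{g⁻¹}` for `f ∈ D̂_{g⁻¹}`. -/
noncomputable def act (g : G) (f : BHat σ) (hf : f ∈ dom σ g⁻¹) : BHat σ :=
  AlgHom.ofLinearMap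
    { toFun := fun w => f.eval (Theta σ g⁻¹ w)
      map_add' := fun w z => by rw [Theta_add, eval_add]
      map_smul' := fun r w => by rw [Theta_smul, eval_smul]; rfl }
    (by
      change f.eval (Theta σ g⁻¹ 1) = 1
      rw [Theta_one]
      exact hf)
    (fun w z => by
      change f.eval (Theta σ g⁻¹ (w * z)) = f.eval (Theta σ g⁻¹ w) * f.eval (Theta σ g⁻¹ z)
      rw [Theta_mul, eval_mul])

theorem eval_act (g : G) (f : BHat σ) (hf : f ∈ dom σ g⁻¹) (w : B σ) :
    (act g f hf).eval w = f.eval (Theta σ g⁻¹ w) := rfl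

theorem eval_act_e (g : G) (f : BHat σ) (hf : f ∈ dom σ g⁻¹) (h : G) :
    (act g f hf).eval (e σ h) = f.eval (e σ (g⁻¹ * h)) := by
  rw [eval_act, Theta_e, eval_mul, show f.eval (e σ g⁻¹) = 1 from hf, mul_one]

theorem mem_dom_one (f : BHat σ) : f ∈ dom σ (1 : G) := by
  have h : e σ (1 : G) = 1 := Subtype.ext (idem_one σ)
  change f.eval (e σ 1) = 1
  rw [h, eval_one]

theorem act_mem_dom_iff (g : G) (f : BHat σ) (hf : f ∈ dom σ g⁻¹) (h : G) :
    act g f hf ∈ dom σ h ↔ f ∈ dom σ (g⁻¹ * h) := by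
  change (act g f hf).eval (e σ h) = 1 ↔ f.eval (e σ (g⁻¹ * h)) = 1
  rw [eval_act_e]

theorem act_mem_dom (g : G) (f : BHat σ) (hf : f ∈ dom σ g⁻¹) : act g f hf ∈ dom σ g := by
  rw [act_mem_dom_iff, inv_mul_cancel]
  exact mem_dom_one f

theorem act_inv_act (g : G) (f : BHat σ) (hf : f ∈ dom σ g⁻¹)
    (hf' : act g f hf ∈ dom σ g⁻¹⁻¹) : act g⁻¹ (act g f hf) hf' = f := by
  refine ext_e fun h => ?_
  rw [eval_act_e, eval_act_e, inv_inv, inv_mul_cancel_left]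

theorem act_act_inv (g : G) (f : BHat σ) (hf : f ∈ dom σ g⁻¹⁻¹)
    (hf' : act g⁻¹ f hf ∈ dom σ g⁻¹) : act g (act g⁻¹ f hf) hf' = f := by
  refine ext_e fun h => ?_
  rw [eval_act_e, eval_act_e, inv_inv, mul_inv_cancel_left]

theorem continuous_act (g : G) :
    Continuous (fun f : dom σ g⁻¹ => act g f.1 f.2) := by
  let _ : TopologicalSpace κ := ⊥
  rw [continuous_induced_rng, continuous_pi_iff]
  intro w
  have hc : Continuous (eval (σ := σ)) := continuous_induced_dom
  exact ((continuous_apply (Theta σ g⁻¹ w)).comp hc).comp continuous_subtype_val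

theorem mem_dom_inv_inv {g : G} {f : BHat σ} (h : f ∈ dom σ g) : f ∈ dom σ g⁻¹⁻¹ := by
  rw [inv_inv]; exact h

/-- The map `act g` as a homeomorphism from `dom σ g⁻¹` onto `dom σ g`. -/
noncomputable def actHomeo (g : G) : dom σ g⁻¹ ≃ₜ dom σ g where
  toFun f := ⟨act g f.1 f.2, act_mem_dom g f.1 f.2⟩
  invFun f := ⟨act g⁻¹ f.1 (mem_dom_inv_inv f.2), act_mem_dom g⁻¹ f.1 (mem_dom_inv_inv f.2)⟩
  left_inv f := Subtype.ext
    (act_inv_act g f.1 f.2 (mem_dom_inv_inv (act_mem_dom g f.1 f.2)))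
  right_inv f := Subtype.ext (act_act_inv g f.1 (mem_dom_inv_inv f.2)
    (act_mem_dom g⁻¹ f.1 (mem_dom_inv_inv f.2)))
  continuous_toFun := (continuous_act g).subtype_mk _
  continuous_invFun := ((continuous_act g⁻¹).comp
    (continuous_subtype_val.subtype_mk fun f : dom σ g => mem_dom_inv_inv f.2)).subtype_mk _

end BHat

/-- The spectral partial action `θ̂` of `G` on the spectrum of `B^σ`. -/
noncomputable def spectralAction (σ : G → G → κ) : TopPartialAction G (BHat σ) where
  dom := BHat.dom σ
  isOpen_dom g := BHat.isOpen_eval_eq (e σ g) 1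
  act := BHat.actHomeo
  dom_one := Set.eq_univ_of_forall BHat.mem_dom_one
  act_one f := BHat.ext_e fun h => by
    change (BHat.act 1 f.1 f.2).eval (e σ h) = _
    rw [BHat.eval_act_e, show (1 : G)⁻¹ * h = h by simp]
  image_act g h := by
    ext f
    constructor
    · rintro ⟨x, hx, rfl⟩
      refine ⟨BHat.act_mem_dom g x.1 x.2, ?_⟩
      change BHat.act g x.1 x.2 ∈ _
      rw [BHat.act_mem_dom_iff, inv_mul_cancel_left]
      exact hx
    · rintro ⟨hf, hf'⟩
      have hi : f ∈ BHat.dom σ g⁻¹⁻¹ := by rw [inv_inv]; exact hf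
      refine ⟨⟨BHat.act g⁻¹ f hi, BHat.act_mem_dom g⁻¹ f hi⟩, ?_,
        BHat.act_act_inv g f hi (BHat.act_mem_dom g⁻¹ f hi)⟩
      change BHat.act g⁻¹ f hi ∈ BHat.dom σ h
      rw [BHat.act_mem_dom_iff, inv_inv]
      exact hf'
  act_act g h f hf hgf := by
    have hy : BHat.act h f hf ∈ BHat.dom σ g⁻¹ := by
      rw [BHat.act_mem_dom_iff, ← mul_inv_rev]
      exact hgf
    refine ⟨hy, BHat.ext_e fun k => ?_⟩
    change (BHat.act g (BHat.act h f hf) hy).eval (e σ k) = (BHat.act (g * h) f hgf).eval (e σ k)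
    rw [BHat.eval_act_e, BHat.eval_act_e, BHat.eval_act_e, mul_inv_rev, mul_assoc]

/-! ## The space `Ω_σ` -/

/-- The `σ`-prohibitions of type I. -/
def prohibitionsI (σ : G → G → κ) : Set (Set G) :=
  {V | ∃ h g s : G, σ g s = 0 ∧ V = {h, h * g, h * g * s}}

/-- The `σ`-prohibitions of type II. -/
def prohibitionsII (σ : G → G → κ) : Set (Set G) :=
  {V | ∃ h g s t : G, σ g (s * t) * σ s t ≠ σ g s * σ (g * s) t ∧
    V = {h, h * g, h * g * s, h * g * s * t}}

/-- The set of `σ`-prohibitions. -/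
def prohibitions (σ : G → G → κ) : Set (Set G) := prohibitionsI σ ∪ prohibitionsII σ

/-- `Ω_σ` as a set of subsets of `G`: those that contain `1` and no `σ`-prohibition. -/
def omegaSet (σ : G → G → κ) : Set (Set G) := {ξ | (1 : G) ∈ ξ ∧ ∀ V ∈ prohibitions σ, ¬ V ⊆ ξ}

/-- The space `Ω_σ`. -/
def Omega (σ : G → G → κ) : Type v := {ξ : Set G // ξ ∈ omegaSet σ}

/-- The set of admissible elements for `ξ ∈ Ω_σ`. -/
def admissible {σ : G → G → κ} (ξ : Omega σ) : Set G := {g | g ∉ ξ.1 ∧ ξ.1 ∪ {g} ∈ omegaSet σ}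

namespace Omega

variable {σ : G → G → κ}

open Classical in
/-- The topology induced from the product topology of `{0,1}^G`. -/
noncomputable instance : TopologicalSpace (Omega σ) :=
  TopologicalSpace.induced (fun ξ (g : G) => decide (g ∈ ξ.1)) Pi.topologicalSpace

variable (σ) in
/-- `𝒟_g^σ = {ξ ∈ Ω_σ : g ∈ ξ}`. -/
def dom (g : G) : Set (Omega σ) := {ξ | g ∈ ξ.1}

theorem isOpen_dom (g : G) : IsOpen (dom σ g) := by
  classical
  have hc : Continuous (fun (ξ : Omega σ) (g : G) => decide (g ∈ ξ.1)) := continuous_induced_dom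
  have := (isOpen_discrete ({true} : Set Bool)).preimage ((continuous_apply g).comp hc)
  convert this using 1
  ext ξ
  simp [dom]

theorem image_mem_prohibitions (g : G) {V : Set G} (hV : V ∈ prohibitions σ) :
    (fun x => g * x) '' V ∈ prohibitions σ := by
  rcases hV with ⟨h, a, s, hz, rfl⟩ | ⟨h, a, s, t, hz, rfl⟩
  · exact Or.inl ⟨g * h, a, s, hz, by simp [Set.image_insert_eq, mul_assoc]⟩
  · exact Or.inr ⟨g * h, a, s, t, hz, by simp [Set.image_insert_eq, mul_assoc]⟩

/-- `ϑ_g(ξ) = gξ` for `ξ ∈ 𝒟_{g⁻¹}^σ`. -/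
def act (g : G) (ξ : Omega σ) (hξ : ξ ∈ dom σ g⁻¹) : Omega σ :=
  ⟨(fun x => g * x) '' ξ.1, ⟨g⁻¹, hξ, mul_inv_cancel g⟩, fun V hV hsub =>
    ξ.2.2 _ (image_mem_prohibitions g⁻¹ hV) (by
      rintro _ ⟨v, hv, rfl⟩
      obtain ⟨x, hx, rfl⟩ := hsub hv
      simpa using hx)⟩

theorem mem_act (g : G) (ξ : Omega σ) (hξ : ξ ∈ dom σ g⁻¹) (x : G) :
    x ∈ (act g ξ hξ).1 ↔ g⁻¹ * x ∈ ξ.1 := by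
  constructor
  · rintro ⟨y, hy, rfl⟩
    simpa using hy
  · intro h
    exact ⟨_, h, mul_inv_cancel_left g x⟩

theorem act_mem_dom (g : G) (ξ : Omega σ) (hξ : ξ ∈ dom σ g⁻¹) : act g ξ hξ ∈ dom σ g := by
  change g ∈ (act g ξ hξ).1
  rw [mem_act, inv_mul_cancel]
  exact ξ.2.1

theorem ext_mem {ξ η : Omega σ} (h : ∀ x, x ∈ ξ.1 ↔ x ∈ η.1) : ξ = η := Subtype.ext (Set.ext h)

theorem act_inv_act (g : G) (ξ : Omega σ) (hξ : ξ ∈ dom σ g⁻¹)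
    (h' : act g ξ hξ ∈ dom σ g⁻¹⁻¹) : act g⁻¹ (act g ξ hξ) h' = ξ :=
  ext_mem fun x => by rw [mem_act, mem_act, inv_inv, inv_mul_cancel_left]

theorem act_act_inv (g : G) (ξ : Omega σ) (hξ : ξ ∈ dom σ g⁻¹⁻¹)
    (h' : act g⁻¹ ξ hξ ∈ dom σ g⁻¹) : act g (act g⁻¹ ξ hξ) h' = ξ :=
  ext_mem fun x => by rw [mem_act, mem_act, inv_inv, mul_inv_cancel_left]

theorem continuous_act (g : G) : Continuous (fun ξ : dom σ g⁻¹ => act g ξ.1 ξ.2) := by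
  classical
  rw [continuous_induced_rng, continuous_pi_iff]
  intro x
  have hc : Continuous (fun (ξ : Omega σ) (g : G) => decide (g ∈ ξ.1)) := continuous_induced_dom
  have := ((continuous_apply (g⁻¹ * x)).comp hc).comp
    (continuous_subtype_val (p := fun ξ => ξ ∈ dom σ g⁻¹))
  convert this using 1
  ext ξ
  simp [mem_act]

theorem mem_dom_inv_inv {g : G} {ξ : Omega σ} (h : ξ ∈ dom σ g) : ξ ∈ dom σ g⁻¹⁻¹ := by
  rw [inv_inv]; exact h

/-- The map `act g` as a homeomorphism from `dom σ g⁻¹` onto `dom σ g`. -/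
noncomputable def actHomeo (g : G) : dom σ g⁻¹ ≃ₜ dom σ g where
  toFun ξ := ⟨act g ξ.1 ξ.2, act_mem_dom g ξ.1 ξ.2⟩
  invFun ξ := ⟨act g⁻¹ ξ.1 (mem_dom_inv_inv ξ.2), act_mem_dom g⁻¹ ξ.1 (mem_dom_inv_inv ξ.2)⟩
  left_inv ξ := Subtype.ext
    (act_inv_act g ξ.1 ξ.2 (mem_dom_inv_inv (act_mem_dom g ξ.1 ξ.2)))
  right_inv ξ := Subtype.ext (act_act_inv g ξ.1 (mem_dom_inv_inv ξ.2)
    (act_mem_dom g⁻¹ ξ.1 (mem_dom_inv_inv ξ.2)))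
  continuous_toFun := (continuous_act g).subtype_mk _
  continuous_invFun := ((continuous_act g⁻¹).comp
    (continuous_subtype_val.subtype_mk fun ξ : dom σ g => mem_dom_inv_inv ξ.2)).subtype_mk _

end Omega

/-- The spectral partial action on `Ω_σ`: `ϑ_g : 𝒟_{g⁻¹}^σ → 𝒟_g^σ`, `ϑ_g(ξ) = gξ`. -/
noncomputable def omegaAction (σ : G → G → κ) : TopPartialAction G (Omega σ) where
  dom := Omega.dom σ
  isOpen_dom := Omega.isOpen_dom
  act := Omega.actHomeo
  dom_one := Set.eq_univ_of_forall fun ξ => ξ.2.1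
  act_one ξ := Omega.ext_mem fun x => by
    change x ∈ (Omega.act 1 ξ.1 ξ.2).1 ↔ _
    rw [Omega.mem_act, show (1 : G)⁻¹ * x = x by simp]
  image_act g h := by
    ext ξ
    constructor
    · rintro ⟨x, hx, rfl⟩
      refine ⟨Omega.act_mem_dom g x.1 x.2, ?_⟩
      change g * h ∈ (Omega.act g x.1 x.2).1
      rw [Omega.mem_act, inv_mul_cancel_left]
      exact hx
    · rintro ⟨hξ, hξ'⟩
      have hi : ξ ∈ Omega.dom σ g⁻¹⁻¹ := by rw [inv_inv]; exact hξ
      refine ⟨⟨Omega.act g⁻¹ ξ hi, Omega.act_mem_dom g⁻¹ ξ hi⟩, ?_,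
        Omega.act_act_inv g ξ hi (Omega.act_mem_dom g⁻¹ ξ hi)⟩
      change h ∈ (Omega.act g⁻¹ ξ hi).1
      rw [Omega.mem_act, inv_inv]
      exact hξ'
  act_act g h ξ hξ hgξ := by
    have hy : Omega.act h ξ hξ ∈ Omega.dom σ g⁻¹ := by
      change g⁻¹ ∈ (Omega.act h ξ hξ).1
      rw [Omega.mem_act, ← mul_inv_rev]
      exact hgξ
    refine ⟨hy, Omega.ext_mem fun x => ?_⟩
    change x ∈ (Omega.act g (Omega.act h ξ hξ) hy).1 ↔ x ∈ (Omega.act (g * h) ξ hgξ).1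
    rw [Omega.mem_act, Omega.mem_act, Omega.mem_act, mul_inv_rev, mul_assoc]

/-- `Fix_g^σ`, the set of fixed points of `g` in `Ω_σ`. -/
def FixSigma (σ : G → G → κ) (g : G) : Set (Omega σ) := (omegaAction σ).fixedSet g

end Algebra

/-! ## Points of the spectrum and points of `Ω_σ` -/

section Spectrum

variable {κ : Type u} {G : Type v} [Field κ] [Group G]

namespace ParAlg

variable (σ : G → G → κ)

/-! The argument takes place in `Omega σ`. Forbidding subsets is a hereditary condition, so
`omegaSet σ` is closed under passing to smaller sets that contain `1` (`omegaSet_mono`). If the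
fixed set of `g ≠ 1` has interior, it contains a cylinder given by finite sets `E` (in) and `F`
(out), and the least member `insert 1 E` is a finite fixed point. An admissible `a` outside `F`
would give a second fixed point with just one more element; as `g` permutes both sets by translation
it would fix `a`, forcing `g = 1`. Hence the admissible set lies in `F`. Conversely, finite `ξ` and
`admissible ξ` define a cylinder containing `ξ` alone, and an isolated fixed point is interior.

The transfer to the spectrum is an equivariant homeomorphism, `BHat.homeoOmega`. The support of a
character avoids prohibitions because the corresponding products of idempotents vanish. For the
inverse, each `ξ` carries an explicit representation on functions `ξ → κ`; evaluated at the point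
`1`, the elements of `B σ` act by scalars, which gives the character. -/

theorem idem_mul_eq_zero {g : G} {x : ParAlg σ} (h : gen σ g⁻¹ * x = 0) :
    idem σ g * x = 0 := by
  rw [idem_eq, smul_mul_assoc, mul_assoc, h, mul_zero, smul_zero]

theorem mul_idem_eq_zero {g : G} {x : ParAlg σ} (h : x * gen σ g = 0) : x * idem σ g = 0 := by
  rw [idem_eq, mul_smul_comm, ← mul_assoc, h, zero_mul, smul_zero]

theorem idem_mul_idem_eq_zero {g s : G} (h : σ g s = 0) : idem σ g * idem σ (g * s) = 0 :=
  mul_idem_eq_zero σ (idem_mul_eq_zero σ (gen_zero_left σ g s h))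

/-- Reducing `[g⁻¹][g][s][t][t⁻¹]` from the left and from the right gives two multiples of
`[g⁻¹][gst][t⁻¹]`. If the scalars differ, this product is zero, and multiplying by suitable
generators turns it into the three idempotents. -/
theorem idem_mul_idem_mul_idem_eq_zero {g s t : G}
    (h : σ g (s * t) * σ s t ≠ σ g s * σ (g * s) t) :
    idem σ g * idem σ (g * s) * idem σ (g * s * t) = 0 := by
  have h1 : gen σ g⁻¹ * gen σ g * gen σ s * gen σ t * gen σ t⁻¹ =
      (σ g s * σ (g * s) t) • (gen σ g⁻¹ * gen σ (g * s * t) * gen σ t⁻¹) := by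
    rw [gen_mul_left, smul_mul_assoc, smul_mul_assoc, mul_assoc _ (gen σ (g * s)),
      mul_assoc _ (gen σ (g * s) * gen σ t), gen_mul_right, mul_smul_comm, smul_smul,
      mul_assoc (gen σ g⁻¹)]
  have h2 : gen σ g⁻¹ * gen σ g * gen σ s * gen σ t * gen σ t⁻¹ =
      (σ g (s * t) * σ s t) • (gen σ g⁻¹ * gen σ (g * s * t) * gen σ t⁻¹) := by
    rw [mul_assoc _ (gen σ s), mul_assoc _ (gen σ s * gen σ t), gen_mul_right, mul_smul_comm,
      ← mul_assoc, gen_mul_left, smul_mul_assoc, smul_smul, mul_comm (σ s t), mul_assoc g]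
  have h3 : gen σ g⁻¹ * gen σ (g * s * t) * gen σ t⁻¹ = 0 := by
    rw [h1, ← sub_eq_zero, ← sub_smul, smul_eq_zero] at h2
    exact h2.resolve_left fun h0 => h (sub_eq_zero.1 h0).symm
  have h4 : idem σ g * gen σ (g * s * t) * idem σ t⁻¹ = 0 := by
    rw [idem_eq σ t⁻¹, inv_inv, mul_smul_comm, mul_assoc, ← mul_assoc (gen σ (g * s * t)),
      ← mul_assoc, idem_mul_eq_zero σ (by rw [← mul_assoc]; exact h3), zero_mul,
      smul_zero]
  refine mul_idem_eq_zero σ ?_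
  rwa [mul_assoc, gen_mul_idem_comm, mul_inv_cancel_right, ← mul_assoc] at h4

/-- Commuting `[h]` to the left through the idempotents strips the translation by `h`. The price is
the factor `e_h`, harmless later because `h` itself belongs to the prohibition. -/
theorem idem_mul_translate_eq_zero (h : G) {a b c : G} (hz : idem σ a * idem σ b * idem σ c = 0) :
    idem σ (h * a) * idem σ (h * b) * idem σ (h * c) * idem σ h = 0 := by
  have key : idem σ (h * a) * idem σ (h * b) * idem σ (h * c) * gen σ h = 0 := by
    rw [mul_assoc, ← gen_mul_idem_comm, mul_assoc, ← mul_assoc (idem σ (h * b)),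
      ← gen_mul_idem_comm, mul_assoc, ← mul_assoc, ← gen_mul_idem_comm, mul_assoc,
      ← mul_assoc _ _ (idem σ c), hz, mul_zero]
  exact mul_idem_eq_zero σ key

end ParAlg

open ParAlg

namespace BHat

variable {σ : G → G → κ}

theorem eval_e_eq_zero_or_one (f : BHat σ) (g : G) : f.eval (e σ g) = 0 ∨ f.eval (e σ g) = 1 := by
  have h : f.eval (e σ g) * f.eval (e σ g) = f.eval (e σ g) := by
    rw [← eval_mul]
    exact congrArg _ (Subtype.ext (idem_mul_self σ g))
  exact (IsIdempotentElem.iff_eq_zero_or_one).1 h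

theorem eval_zero (f : BHat σ) : f.eval 0 = 0 := map_zero (show B σ →ₐ[κ] κ from f)

theorem support_mem_omegaSet (f : BHat σ) : {g | f.eval (e σ g) = 1} ∈ omegaSet σ := by
  refine ⟨mem_dom_one f, ?_⟩
  have key (h a b c : G) (hz : idem σ a * idem σ b * idem σ c = 0)
      (h0 : f.eval (e σ h) = 1) (h1 : f.eval (e σ (h * a)) = 1) (h2 : f.eval (e σ (h * b)) = 1)
      (h3 : f.eval (e σ (h * c)) = 1) : False := by
    have : e σ (h * a) * e σ (h * b) * e σ (h * c) * e σ h = 0 :=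
      Subtype.ext (idem_mul_translate_eq_zero σ h hz)
    have := congrArg f.eval this
    rw [eval_mul, eval_mul, eval_mul, h0, h1, h2, h3, eval_zero] at this
    simp at this
  rintro V (⟨h, g, s, hz, rfl⟩ | ⟨h, g, s, t, hz, rfl⟩) hV
  -- Type I has only two idempotents; `e_1 = 1` pads it to the three-factor form.
  · refine key h 1 g (g * s) ?_ (hV (by simp)) (hV (by simp)) (hV (by simp))
      (hV (by simp [mul_assoc]))
    rw [idem_one, one_mul, idem_mul_idem_eq_zero σ hz]
  · exact key h g (g * s) (g * s * t) (idem_mul_idem_mul_idem_eq_zero σ hz) (hV (by simp))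
      (hV (by simp)) (hV (by simp [mul_assoc])) (hV (by simp [mul_assoc]))

/-- The point `{g : f(e_g) = 1}` of `Ω_σ` determined by a character `f`. -/
noncomputable def toOmega (f : BHat σ) : Omega σ :=
  ⟨{g | f.eval (e σ g) = 1}, f.support_mem_omegaSet⟩

theorem mem_toOmega {f : BHat σ} {g : G} : g ∈ f.toOmega.1 ↔ f.eval (e σ g) = 1 := Iff.rfl

/-- The `e_g` generate `B σ` and take only the values `0` and `1`, so the support determines the
character. -/
theorem toOmega_injective : Function.Injective (toOmega (σ := σ)) := by
  intro f f' h
  refine ext_e fun g => ?_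
  have hg : f.eval (e σ g) = 1 ↔ f'.eval (e σ g) = 1 := by rw [← mem_toOmega, h, mem_toOmega]
  rcases eval_e_eq_zero_or_one f g with h0 | h1
  · rcases eval_e_eq_zero_or_one f' g with h0' | h1'
    · rw [h0, h0']
    · rw [hg.2 h1', h1']
  · rw [h1, hg.1 h1]

theorem toOmega_act (g : G) (f : BHat σ) (hf : f ∈ dom σ g⁻¹) :
    (act g f hf).toOmega = Omega.act g f.toOmega hf := by
  refine Omega.ext_mem fun x => ?_
  refine Iff.trans ?_ (Omega.mem_act g f.toOmega hf x).symm
  rw [mem_toOmega, mem_toOmega, eval_act_e]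

theorem fixedSet_spectralAction (g : G) :
    (spectralAction σ).fixedSet g = toOmega ⁻¹' (omegaAction σ).fixedSet g := by
  ext f
  refine exists_congr fun hf => ?_
  change act g f hf = f ↔ Omega.act g f.toOmega hf = f.toOmega
  exact (toOmega_injective.eq_iff).symm.trans (by rw [toOmega_act g f hf])

end BHat

/-! ## The representation attached to a point of `Ω_σ` -/

/-- This normalisation is what the factor set hypothesis supplies: it makes `[1]` act as the
identity in the representations below. -/
theorem sigma_one_left_of_ne_zero {σ : G → G → κ} (hσ : σ ∈ pm κ G) {h : G} (hz : σ 1 h ≠ 0) :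
    σ 1 h = 1 := by
  obtain ⟨R, _, _, _, Γ, hΓ⟩ := hσ
  have h1 := hΓ.mul_left 1 h
  rw [inv_one, hΓ.map_one, one_mul, one_mul, one_mul, one_mul] at h1
  have h2 : Γ h ≠ 0 := fun h0 => hz (hΓ.eq_zero 1 h (by rw [h0, mul_zero]))
  have h3 : (1 - σ 1 h) • Γ h = 0 := by rw [sub_smul, one_smul, ← h1, sub_self]
  exact (sub_eq_zero.1 ((smul_eq_zero.1 h3).resolve_right h2)).symm

namespace Omega

variable {σ : G → G → κ}

theorem sigma_ne_zero (ξ : Omega σ) {h g s : G} (h0 : h ∈ ξ.1) (h1 : h * g ∈ ξ.1)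
    (h2 : h * g * s ∈ ξ.1) : σ g s ≠ 0 := fun hz =>
  ξ.2.2 _ (Or.inl ⟨h, g, s, hz, rfl⟩) (by simp [Set.insert_subset_iff, *])

theorem sigma_cocycle (ξ : Omega σ) {h g s t : G} (h0 : h ∈ ξ.1) (h1 : h * g ∈ ξ.1)
    (h2 : h * g * s ∈ ξ.1) (h3 : h * g * s * t ∈ ξ.1) :
    σ g (s * t) * σ s t = σ g s * σ (g * s) t := by
  by_contra hz
  exact ξ.2.2 _ (Or.inr ⟨h, g, s, t, hz, rfl⟩) (by simp [Set.insert_subset_iff, *])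

theorem sigma_one_left (hσ : σ ∈ pm κ G) (ξ : Omega σ) {h : G} (hh : h ∈ ξ.1) : σ 1 h⁻¹ = 1 :=
  sigma_one_left_of_ne_zero hσ
    (ξ.sigma_ne_zero (h := h) hh (by simpa using hh) (by simpa using ξ.2.1))

open Classical in
/-- The operator by which `[g]` acts on the functions on `ξ`. -/
noncomputable def op (ξ : Omega σ) (g : G) : Module.End κ (ξ.1 → κ) where
  -- Right translation by `g`, cut off to `ξ`. The weight is chosen so that composing two operators
  -- meets the cocycle identity along `k, kg, kgh, 1`.
  toFun φ k := if h : k.1 * g ∈ ξ.1 then σ g (k.1 * g)⁻¹ * φ ⟨k.1 * g, h⟩ else 0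
  map_add' φ ψ := by
    ext k
    by_cases h : k.1 * g ∈ ξ.1 <;> simp [h, mul_add]
  map_smul' r φ := by
    ext k
    by_cases h : k.1 * g ∈ ξ.1 <;> simp [h, mul_left_comm]

theorem op_apply_of_mem (ξ : Omega σ) {g k l : G} (φ : ξ.1 → κ) (hk : k ∈ ξ.1) (hl : l ∈ ξ.1)
    (h : k * g = l) : ξ.op g φ ⟨k, hk⟩ = σ g l⁻¹ * φ ⟨l, hl⟩ := by
  subst h
  exact dif_pos hl

theorem op_apply_of_notMem (ξ : Omega σ) {g k : G} (φ : ξ.1 → κ) (hk : k ∈ ξ.1)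
    (h : k * g ∉ ξ.1) : ξ.op g φ ⟨k, hk⟩ = 0 := dif_neg h

theorem op_one (hσ : σ ∈ pm κ G) (ξ : Omega σ) : ξ.op 1 = 1 := by
  ext φ ⟨k, hk⟩
  rw [ξ.op_apply_of_mem φ hk hk (mul_one k), ξ.sigma_one_left hσ hk, one_mul]
  rfl

/-- A nonzero value at `k` would need `kg⁻¹`, `k` and `kh` all in `ξ`, which is a type I
prohibition. -/
theorem op_zero_left (ξ : Omega σ) {g h : G} (hz : σ g h = 0) : ξ.op g⁻¹ * ξ.op (g * h) = 0 := by
  ext φ ⟨k, hk⟩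
  rw [Module.End.mul_apply]
  by_cases h1 : k * g⁻¹ ∈ ξ.1
  · rw [ξ.op_apply_of_mem _ hk h1 rfl]
    by_cases h2 : k * h ∈ ξ.1
    · exact absurd hz (ξ.sigma_ne_zero h1 (by simpa using hk) (by simpa using h2))
    · rw [ξ.op_apply_of_notMem _ h1 (by simpa [mul_assoc] using h2), mul_zero]
      rfl
  · rw [ξ.op_apply_of_notMem _ hk h1]
    rfl

theorem op_zero_right (ξ : Omega σ) {g h : G} (hz : σ g h = 0) : ξ.op (g * h) * ξ.op h⁻¹ = 0 := by
  ext φ ⟨k, hk⟩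
  rw [Module.End.mul_apply]
  by_cases h1 : k * (g * h) ∈ ξ.1
  · rw [ξ.op_apply_of_mem _ hk h1 rfl]
    by_cases h2 : k * g ∈ ξ.1
    · exact absurd hz (ξ.sigma_ne_zero hk h2 (by simpa [mul_assoc] using h1))
    · rw [ξ.op_apply_of_notMem _ h1 (by simpa [mul_assoc] using h2), mul_zero]
      rfl
  · rw [ξ.op_apply_of_notMem _ hk h1]
    rfl

/-- The twisted product rule holds at `k` as soon as the intermediate point `kg` lies in `ξ`. The
outer factors `[g⁻¹]` and `[h⁻¹]` in the defining relations take care of that condition. -/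
theorem op_mul_op (ξ : Omega σ) {g h k : G} (φ : ξ.1 → κ) (hk : k ∈ ξ.1) (hg : k * g ∈ ξ.1) :
    ξ.op g (ξ.op h φ) ⟨k, hk⟩ = σ g h * ξ.op (g * h) φ ⟨k, hk⟩ := by
  rw [ξ.op_apply_of_mem _ hk hg rfl]
  by_cases h1 : k * g * h ∈ ξ.1
  · rw [ξ.op_apply_of_mem _ hg h1 rfl, ξ.op_apply_of_mem _ hk h1 (mul_assoc k g h).symm]
    have := ξ.sigma_cocycle (t := (k * g * h)⁻¹) hk hg h1 (by simpa using ξ.2.1)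
    rw [show h * (k * g * h)⁻¹ = (k * g)⁻¹ by group] at this
    rw [← mul_assoc, this, mul_assoc]
  · rw [ξ.op_apply_of_notMem _ hg h1, ξ.op_apply_of_notMem _ hk (by rwa [← mul_assoc]), mul_zero,
      mul_zero]

theorem op_mul_left (ξ : Omega σ) (g h : G) :
    ξ.op g⁻¹ * ξ.op g * ξ.op h = σ g h • (ξ.op g⁻¹ * ξ.op (g * h)) := by
  ext φ ⟨k, hk⟩
  change ξ.op g⁻¹ (ξ.op g (ξ.op h φ)) ⟨k, hk⟩ = σ g h * ξ.op g⁻¹ (ξ.op (g * h) φ) ⟨k, hk⟩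
  by_cases h1 : k * g⁻¹ ∈ ξ.1
  · rw [ξ.op_apply_of_mem _ hk h1 rfl, ξ.op_apply_of_mem _ hk h1 rfl,
      ξ.op_mul_op φ h1 (by simpa using hk), mul_left_comm]
  · rw [ξ.op_apply_of_notMem _ hk h1, ξ.op_apply_of_notMem _ hk h1, mul_zero]

theorem op_mul_right (ξ : Omega σ) (g h : G) :
    ξ.op g * ξ.op h * ξ.op h⁻¹ = σ g h • (ξ.op (g * h) * ξ.op h⁻¹) := by
  ext φ ⟨k, hk⟩
  change ξ.op g (ξ.op h (ξ.op h⁻¹ φ)) ⟨k, hk⟩ = σ g h * ξ.op (g * h) (ξ.op h⁻¹ φ) ⟨k, hk⟩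
  by_cases h1 : k * g ∈ ξ.1
  · exact ξ.op_mul_op _ hk h1
  · rw [ξ.op_apply_of_notMem _ hk h1]
    -- The right side must vanish too: its factor `ξ.op h⁻¹` leads from `kgh` back to `kg`, which is
    -- not in `ξ`.
    by_cases h2 : k * (g * h) ∈ ξ.1
    · rw [ξ.op_apply_of_mem _ hk h2 rfl, ξ.op_apply_of_notMem _ h2 (by simpa [mul_assoc] using h1),
        mul_zero, mul_zero]
    · rw [ξ.op_apply_of_notMem _ hk h2, mul_zero]

/-- The representation of the twisted partial group algebra on the functions on `ξ`. -/
noncomputable def rep (hσ : σ ∈ pm κ G) (ξ : Omega σ) :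
    ParAlg σ →ₐ[κ] Module.End κ (ξ.1 → κ) :=
  RingQuot.liftAlgHom κ ⟨FreeAlgebra.lift κ ξ.op, fun x y hxy => by
    induction hxy with
    | one => simp [ξ.op_one hσ]
    | zero_left g h hz => simp [ξ.op_zero_left hz]
    | zero_right g h hz => simp [ξ.op_zero_right hz]
    | mul_left g h => simp [ξ.op_mul_left]
    | mul_right g h => simp [ξ.op_mul_right]⟩

theorem rep_gen (hσ : σ ∈ pm κ G) (ξ : Omega σ) (g : G) : ξ.rep hσ (gen σ g) = ξ.op g := by
  refine (RingQuot.liftAlgHom_mkAlgHom_apply κ _ _ _).trans ?_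
  simp

/-! ### Characters of `B σ` obtained from the representations. -/

open Classical in
theorem rep_idem (hσ : σ ∈ pm κ G) (ξ : Omega σ) (g : G) (φ : ξ.1 → κ) :
    ξ.rep hσ (idem σ g) φ ⟨1, ξ.2.1⟩ = (if g ∈ ξ.1 then 1 else 0) * φ ⟨1, ξ.2.1⟩ := by
  rw [idem_eq, map_smul, map_mul, rep_gen, rep_gen]
  change (σ g g⁻¹)⁻¹ * ξ.op g (ξ.op g⁻¹ φ) ⟨1, ξ.2.1⟩ = _
  split_ifs with hg
  · rw [ξ.op_mul_op _ ξ.2.1 (by simpa using hg), mul_inv_cancel, ξ.op_one hσ, ← mul_assoc,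
      inv_mul_cancel₀ (ξ.sigma_ne_zero ξ.2.1 (by simpa using hg) (by simpa using ξ.2.1))]
    rfl
  · rw [ξ.op_apply_of_notMem _ ξ.2.1 (by simpa using hg), mul_zero, zero_mul]

/-- The value at `1` of `w` applied to the constant function `1`. -/
noncomputable def character (hσ : σ ∈ pm κ G) (ξ : Omega σ) (w : ParAlg σ) : κ :=
  ξ.rep hσ w 1 ⟨1, ξ.2.1⟩

/-- Multiplicativity of the character rests on this scalar action at `1`. The function `φ` is
arbitrary because, for a product `x * y`, the inductive hypothesis for `x` is applied to the image
of `φ` under `y`. -/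
theorem rep_apply_one (hσ : σ ∈ pm κ G) (ξ : Omega σ) {w : ParAlg σ} (hw : w ∈ B σ)
    (φ : ξ.1 → κ) : ξ.rep hσ w φ ⟨1, ξ.2.1⟩ = ξ.character hσ w * φ ⟨1, ξ.2.1⟩ := by
  unfold character
  induction hw using Algebra.adjoin_induction generalizing φ with
  | mem x hx =>
    obtain ⟨g, rfl⟩ := hx
    rw [rep_idem, rep_idem, Pi.one_apply, mul_one]
  | algebraMap r => simp [Module.algebraMap_end_apply]
  | add x y _ _ hx hy =>
    rw [map_add, LinearMap.add_apply, Pi.add_apply, hx, hy, LinearMap.add_apply, Pi.add_apply,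
      add_mul]
  | mul x y _ _ hx hy =>
    rw [map_mul, Module.End.mul_apply, hx, hy φ, Module.End.mul_apply, hx (ξ.rep hσ y 1),
      mul_assoc]

theorem character_mul (hσ : σ ∈ pm κ G) (ξ : Omega σ) {x : ParAlg σ} (hx : x ∈ B σ)
    (y : ParAlg σ) : ξ.character hσ (x * y) = ξ.character hσ x * ξ.character hσ y := by
  rw [character, map_mul, Module.End.mul_apply, rep_apply_one hσ ξ hx]
  rfl

open Classical in
theorem character_idem (hσ : σ ∈ pm κ G) (ξ : Omega σ) (g : G) :
    ξ.character hσ (idem σ g) = if g ∈ ξ.1 then 1 else 0 := by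
  rw [character, rep_idem, Pi.one_apply, mul_one]

/-- The character of `B^σ` determined by a point of `Ω_σ`. -/
noncomputable def toBHat (hσ : σ ∈ pm κ G) (ξ : Omega σ) : BHat σ :=
  AlgHom.ofLinearMap
    { toFun := fun w => ξ.character hσ w
      map_add' := fun w z => by simp [character]
      map_smul' := fun r w => by simp [character] }
    (by simp [character]) (fun w z => ξ.character_mul hσ w.2 z)

theorem eval_toBHat (hσ : σ ∈ pm κ G) (ξ : Omega σ) (w : B σ) :
    (ξ.toBHat hσ).eval w = ξ.character hσ w := rfl

theorem toOmega_toBHat (hσ : σ ∈ pm κ G) (ξ : Omega σ) : (ξ.toBHat hσ).toOmega = ξ :=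
  ext_mem fun g => by
    rw [BHat.mem_toOmega, eval_toBHat]
    change ξ.character hσ (idem σ g) = 1 ↔ _
    rw [character_idem]
    split_ifs with h <;> simp [h]

/-! ### Continuity of the identification and transfer of topological freeness. -/

theorem isClosed_dom (g : G) : IsClosed (dom σ g) := by
  classical
  have hc : Continuous (fun (ξ : Omega σ) (g : G) => decide (g ∈ ξ.1)) := continuous_induced_dom
  have := (isClosed_discrete ({true} : Set Bool)).preimage ((continuous_apply g).comp hc)
  convert this using 1
  ext ξ
  simp [dom]

/-- On a generator `e_g` the value is the indicator of a clopen set, and local constancy survives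
sums and products. -/
theorem isLocallyConstant_character (hσ : σ ∈ pm κ G) {w : ParAlg σ} (hw : w ∈ B σ) :
    IsLocallyConstant fun ξ : Omega σ => ξ.character hσ w := by
  induction hw using Algebra.adjoin_induction with
  | mem x hx =>
    classical
    obtain ⟨g, rfl⟩ := hx
    simp only [character_idem]
    let _ : TopologicalSpace κ := ⊥
    have _ : DiscreteTopology κ := ⟨rfl⟩
    refine (IsLocallyConstant.iff_continuous _).2 (continuous_const.if ?_ continuous_const)
    intro ξ hξ
    have : IsClopen {ξ : Omega σ | g ∈ ξ.1} := ⟨isClosed_dom g, isOpen_dom g⟩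
    rw [this.frontier_eq] at hξ
    exact hξ.elim
  | algebraMap r =>
    convert IsLocallyConstant.const r with ξ
    simp [character, Module.algebraMap_end_apply]
  | add x y _ _ hx hy =>
    convert hx.add hy using 2 with ξ
    simp [character]
  | mul x y hxB _ hx hy =>
    convert hx.mul hy using 2 with ξ
    exact ξ.character_mul hσ hxB y

theorem continuous_toBHat (hσ : σ ∈ pm κ G) :
    Continuous (toBHat hσ : Omega σ → BHat σ) := by
  let _ : TopologicalSpace κ := ⊥
  rw [continuous_induced_rng, continuous_pi_iff]
  exact fun w => (isLocallyConstant_character hσ w.2).continuous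

end Omega

theorem BHat.continuous_toOmega {σ : G → G → κ} : Continuous (toOmega (σ := σ)) := by
  classical
  rw [continuous_induced_rng, continuous_pi_iff]
  intro g
  let _ : TopologicalSpace κ := ⊥
  have _ : DiscreteTopology κ := ⟨rfl⟩
  have hc : Continuous (eval (σ := σ)) := continuous_induced_dom
  exact (continuous_of_discreteTopology (f := fun a : κ => decide (a = 1))).comp
    ((continuous_apply (e σ g)).comp hc)

/-- The identification of the spectrum of `B^σ` with `Ω_σ`. -/
noncomputable def BHat.homeoOmega {σ : G → G → κ} (hσ : σ ∈ pm κ G) : BHat σ ≃ₜ Omega σ where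
  toFun := toOmega
  invFun := Omega.toBHat hσ
  left_inv f := toOmega_injective (Omega.toOmega_toBHat hσ f.toOmega)
  right_inv := Omega.toOmega_toBHat hσ
  continuous_toFun := continuous_toOmega
  continuous_invFun := Omega.continuous_toBHat hσ

theorem topologicallyFree_spectralAction_iff {σ : G → G → κ} (hσ : σ ∈ pm κ G) :
    (spectralAction σ).TopologicallyFree ↔ (omegaAction σ).TopologicallyFree := by
  refine forall₂_congr fun g _ => ?_
  rw [BHat.fixedSet_spectralAction]
  change interior ((BHat.homeoOmega hσ) ⁻¹' _) = ∅ ↔ _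
  rw [← Homeomorph.preimage_interior, Set.preimage_eq_empty_iff,
    (BHat.homeoOmega hσ).surjective.range_eq, Set.disjoint_univ]

end Spectrum

/-! ## Isolated fixed points in `Ω_σ` -/

section Isolated

variable {κ : Type u} {G : Type v} [Field κ] [Group G] {σ : G → G → κ}

/-- Heredity allows a point of a cylinder to be shrunk to a finite one. -/
theorem omegaSet_mono {ξ η : Set G} (hξ : ξ ∈ omegaSet σ) (h1 : 1 ∈ η) (h : η ⊆ ξ) :
    η ∈ omegaSet σ := ⟨h1, fun V hV hVη => hξ.2 V hV (hVη.trans h)⟩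

namespace Omega

theorem isOpen_cylinder {E F : Set G} (hE : E.Finite) (hF : F.Finite) :
    IsOpen {η : Omega σ | E ⊆ η.1 ∧ Disjoint F η.1} := by
  have : {η : Omega σ | E ⊆ η.1 ∧ Disjoint F η.1} =
      (⋂ g ∈ E, dom σ g) ∩ ⋂ g ∈ F, (dom σ g)ᶜ := by
    ext η
    simp [dom, Set.subset_def, Set.disjoint_left]
  rw [this]
  exact (hE.isOpen_biInter fun g _ => isOpen_dom g).inter
    (hF.isOpen_biInter fun g _ => (isClosed_dom g).isOpen_compl)

theorem exists_cylinder_subset {U : Set (Omega σ)} (hU : IsOpen U) {ξ : Omega σ} (hξ : ξ ∈ U) :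
    ∃ E F : Set G, E.Finite ∧ F.Finite ∧ E ⊆ ξ.1 ∧ Disjoint F ξ.1 ∧
      ∀ η : Omega σ, E ⊆ η.1 → Disjoint F η.1 → η ∈ U := by
  classical
  obtain ⟨V, hV, rfl⟩ := isOpen_induced_iff.1 hU
  obtain ⟨I, u, hu, hIV⟩ := isOpen_pi_iff.1 hV _ hξ
  -- A basic neighbourhood constrains finitely many coordinates `I`; they are split by the value of
  -- `ξ` there.
  refine ⟨I ∩ ξ.1, I \ ξ.1, I.finite_toSet.inter_of_left _, I.finite_toSet.sdiff,
    Set.inter_subset_right, Set.disjoint_sdiff_left, fun η hE hF => hIV fun g hg => ?_⟩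
  have : g ∈ η.1 ↔ g ∈ ξ.1 :=
    ⟨fun h => by_contra fun h' => Set.disjoint_left.1 hF ⟨hg, h'⟩ h, fun h => hE ⟨hg, h⟩⟩
  simpa only [this] using (hu g hg).2

/-- By heredity, any element of `η` outside `ξ` is admissible for `ξ`, since adjoining it alone
stays inside `η`. -/
theorem eq_of_subset_of_disjoint_admissible {ξ η : Omega σ} (h : ξ.1 ⊆ η.1)
    (hd : Disjoint (admissible ξ) η.1) : η = ξ := by
  refine Subtype.ext (Set.Subset.antisymm (fun g hg => by_contra fun hgξ => ?_) h)
  exact Set.disjoint_left.1 hd ⟨hgξ, omegaSet_mono η.2 (Or.inl ξ.2.1)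
    (Set.union_subset h (Set.singleton_subset_iff.2 hg))⟩ hg

theorem isOpen_singleton_of_finite {ξ : Omega σ} (h : ξ.1.Finite) (ha : (admissible ξ).Finite) :
    IsOpen ({ξ} : Set (Omega σ)) := by
  convert isOpen_cylinder (σ := σ) h ha using 1
  ext η
  refine ⟨?_, fun hη => eq_of_subset_of_disjoint_admissible hη.1 hη.2⟩
  rintro rfl
  exact ⟨Set.Subset.rfl, Set.disjoint_left.2 fun g hg => hg.1⟩

theorem mul_mem_iff_of_mem_fixSigma {g : G} {ξ : Omega σ} (h : ξ ∈ FixSigma σ g) (x : G) :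
    g * x ∈ ξ.1 ↔ x ∈ ξ.1 := by
  obtain ⟨hξ, hfix⟩ := h
  change act g ξ hξ = ξ at hfix
  have := mem_act g ξ hξ (g * x)
  rwa [hfix, inv_mul_cancel_left] at this

theorem exists_finite_fixed_of_interior_nonempty {g : G} (hg : g ≠ 1)
    (h : (interior (FixSigma σ g)).Nonempty) :
    ∃ ξ ∈ FixSigma σ g, ξ.1.Finite ∧ (admissible ξ).Finite := by
  obtain ⟨ξ, hξ⟩ := h
  obtain ⟨E, F, hE, hF, hEξ, hFξ, hfix⟩ := exists_cylinder_subset isOpen_interior hξ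
  replace hfix (η : Omega σ) (h1 : E ⊆ η.1) (h2 : Disjoint F η.1) : η ∈ FixSigma σ g :=
    interior_subset (hfix η h1 h2)
  have hsub : insert 1 E ⊆ ξ.1 := Set.insert_subset ξ.2.1 hEξ
  -- The least member of the cylinder.
  let η : Omega σ := ⟨insert 1 E, omegaSet_mono ξ.2 (Set.mem_insert _ _) hsub⟩
  have hFη : Disjoint F η.1 := hFξ.mono_right hsub
  have hη : η ∈ FixSigma σ g := hfix η (Set.subset_insert _ _) hFη
  refine ⟨η, hη, hE.insert 1, hF.subset fun a ha => by_contra fun haF => ?_⟩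
  have hζ : (⟨η.1 ∪ {a}, ha.2⟩ : Omega σ) ∈ FixSigma σ g :=
    hfix _ ((Set.subset_insert _ _).trans Set.subset_union_left)
      (Set.disjoint_union_right.2 ⟨hFη, Set.disjoint_singleton_right.2 haF⟩)
  -- Either `g * a` lies in `η`, so invariance of `η` puts `a` there, or `g * a = a`; both are
  -- impossible.
  rcases (mul_mem_iff_of_mem_fixSigma hζ a).2 (Or.inr rfl) with h | h
  · exact ha.1 ((mul_mem_iff_of_mem_fixSigma hη a).1 h)
  · exact hg (mul_eq_right.1 h)

end Omega

end Isolated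

theorem mainTheorem3 {κ : Type u} {G : Type v} [Field κ] [Group G] [Infinite G]
    (σ : G → G → κ) (hσ : σ ∈ pm κ G) :
    List.TFAE [
      ¬ (spectralAction σ).TopologicallyFree,
      ¬ (omegaAction σ).TopologicallyFree,
      ∃ g : G, g ≠ 1 ∧ ∃ ξ ∈ FixSigma σ g, IsOpen ({ξ} : Set (Omega σ)),
      ∃ g : G, g ≠ 1 ∧ ∃ ξ ∈ FixSigma σ g, ξ.1.Finite ∧ (admissible ξ).Finite] := by
  tfae_have 1 ↔ 2 := not_congr (topologicallyFree_spectralAction_iff hσ)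
  tfae_have 2 → 4 := by
    intro h
    simp only [TopPartialAction.TopologicallyFree, not_forall] at h
    obtain ⟨g, hg, hne⟩ := h
    exact ⟨g, hg, Omega.exists_finite_fixed_of_interior_nonempty hg
      (Set.nonempty_iff_ne_empty.2 hne)⟩
  tfae_have 4 → 3 := by
    rintro ⟨g, hg, ξ, hξ, hfin, hadm⟩
    exact ⟨g, hg, ξ, hξ, Omega.isOpen_singleton_of_finite hfin hadm⟩
  tfae_have 3 → 2 := by
    rintro ⟨g, hg, ξ, hξ, hopen⟩ hfree
    have : ξ ∈ interior ((omegaAction σ).fixedSet g) :=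
      interior_maximal (Set.singleton_subset_iff.2 hξ) hopen rfl
    rw [hfree g hg] at this
    exact this
  tfae_finish
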